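/- Let $p$ be a prime and let $\mathbb{P}^1(\mathbb{Q}_p)$ carry the spherical metric $$\rho([x_1:y_1],[x_2:y_2])=\frac{|x_1y_2-x_2y_1|_p}{\max\{|x_1|_p,|y_1|_p\}\,\max\{|x_2|_p,|y_2|_p\}}.$$ The degree of a rational function over a field is the maximum of the degrees of its numerator and denominator in lowest terms. Write $\phi\in\mathbb{Q}_p(z)$ as $\phi=f/g$ with $f,g\in\mathbb{Z}_p[z]$ having no common factors and at least one coefficient of $f$ or $g$ of absolute value $1$; $\phi$ has good reduction if the rational function $\overline{f}/\overline{g}$ over $\mathbb{F}_p$ (reduction of coefficients modulo $p$, common factors cancelled) has the same degree as $\phi$. A minimal component of $\phi$ is a nonempty clopen set $E\subset\mathbb{P}^1(\mathbb{Q}_p)$ that is a finite union of balls $\{x:\rho(x,a)\le p^{-n}\}$ ($n\ge 1$), satisfies $\phi(E)\subset E$, and in which the orbit under $\phi$ of every point of $E$ is dense. For a sequence $(p_s)_{s\ge1}$ of positive integers with $p_s\mid p_{s+1}$ for all $s$, the odometer $\mathbb{Z}_{(p_s)}$ with structure sequence $(p_s)$ is the inverse limit of the rings $\mathbb{Z}/p_s\mathbb{Z}$,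 with the inverse limit topology, and the adding machine on it is the map $z\mapsto z+1$. **Theorem.** Let $\phi\in\mathbb{Q}_p(z)$ be a rational map of degree at least $2$ with good reduction, and let $E\subset\mathbb{P}^1(\mathbb{Q}_p)$ be a minimal component of $\phi$. Then there are positive integers $k$ and $\ell$ with $1\le k\le p+1$ and $\ell\mid p-1$ such that $\phi|_E:E\to E$ is topologically conjugate to the adding machine on the odometer with structure sequence $$(k,\ k\ell,\ k\ell p,\ k\ell p^2,\ \dots).$$ -/

import Mathlib

open Polynomial

noncomputable section

namespace PadicGoodReduction

/-! ### The projective line and its spherical metric -/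

/-- The projective line over `ℚ_p`; the point `[x : y]` is the class of `![x, y]`. -/
abbrev P1 (p : ℕ) [Fact p.Prime] : Type := Projectivization ℚ_[p] (Fin 2 → ℚ_[p])

section Metric

variable {p : ℕ} [Fact p.Prime]

/-- The spherical distance in homogeneous coordinates. The norm on `Fin 2 → ℚ_[p]` is the
sup norm, so `‖v‖ = max (|v 0|_p) (|v 1|_p)`. -/
def coordDist (v w : Fin 2 → ℚ_[p]) : ℝ := ‖v 0 * w 1 - w 0 * v 1‖ / (‖v‖ * ‖w‖)

theorem coordDist_smul {a b : ℚ_[p]} (ha : a ≠ 0) (hb : b ≠ 0) (v w : Fin 2 → ℚ_[p]) :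
    coordDist (a • v) (b • w) = coordDist v w := by
  have ha' : ‖a‖ ≠ 0 := norm_ne_zero_iff.2 ha
  have hb' : ‖b‖ ≠ 0 := norm_ne_zero_iff.2 hb
  have h : (a • v) 0 * (b • w) 1 - (b • w) 0 * (a • v) 1
      = (a * b) * (v 0 * w 1 - w 0 * v 1) := by
    simp only [Pi.smul_apply, smul_eq_mul]; ring
  unfold coordDist
  rw [h, norm_smul, norm_smul, norm_mul, norm_mul,
    show ‖a‖ * ‖v‖ * (‖b‖ * ‖w‖) = (‖a‖ * ‖b‖) * (‖v‖ * ‖w‖) by ring]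
  exact mul_div_mul_left _ _ (mul_ne_zero ha' hb')

/-- The spherical metric `ρ` on `ℙ¹(ℚ_p)`. -/
def sphericalDist (P Q : P1 p) : ℝ := coordDist P.rep Q.rep

/-- The spherical metric can be computed with any choice of homogeneous coordinates. -/
theorem sphericalDist_mk (v w : Fin 2 → ℚ_[p]) (hv : v ≠ 0) (hw : w ≠ 0) :
    sphericalDist (Projectivization.mk ℚ_[p] v hv) (Projectivization.mk ℚ_[p] w hw)
      = coordDist v w := by
  obtain ⟨a, ha⟩ := Projectivization.exists_smul_eq_mk_rep ℚ_[p] v hv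
  obtain ⟨b, hb⟩ := Projectivization.exists_smul_eq_mk_rep ℚ_[p] w hw
  unfold sphericalDist
  rw [← ha, ← hb]
  exact coordDist_smul a.ne_zero b.ne_zero v w

theorem coordDist_ultra (u v w : Fin 2 → ℚ_[p]) (hu : u ≠ 0) (hv : v ≠ 0) (hw : w ≠ 0) :
    coordDist u w ≤ max (coordDist u v) (coordDist v w) := by
  have hu' : 0 < ‖u‖ := norm_pos_iff.2 hu
  have hv' : 0 < ‖v‖ := norm_pos_iff.2 hv
  have hw' : 0 < ‖w‖ := norm_pos_iff.2 hw
  set A := ‖u 0 * v 1 - v 0 * u 1‖ with hA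
  set B := ‖v 0 * w 1 - w 0 * v 1‖ with hB
  set C := ‖u 0 * w 1 - w 0 * u 1‖ with hC
  have key : C * ‖v‖ ≤ max (A * ‖w‖) (B * ‖u‖) := by
    rw [hC, ← norm_smul, pi_norm_le_iff_of_nonneg (by positivity)]
    have comp : ∀ i, ((u 0 * w 1 - w 0 * u 1) • v) i
        = (u 0 * v 1 - v 0 * u 1) * w i + (v 0 * w 1 - w 0 * v 1) * u i := by
      intro i
      fin_cases i <;> simp <;> ring
    intro i
    rw [comp i]
    refine (IsUltrametricDist.norm_add_le_max _ _).trans (max_le_max ?_ ?_)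
    · rw [norm_mul]; exact mul_le_mul_of_nonneg_left (norm_le_pi_norm w i) (norm_nonneg _)
    · rw [norm_mul]; exact mul_le_mul_of_nonneg_left (norm_le_pi_norm u i) (norm_nonneg _)
  have e1 : coordDist u w = C * ‖v‖ / (‖u‖ * ‖v‖ * ‖w‖) := by
    unfold coordDist; rw [← hC]; field_simp
  have e2 : coordDist u v = A * ‖w‖ / (‖u‖ * ‖v‖ * ‖w‖) := by
    unfold coordDist; rw [← hA]; field_simp
  have e3 : coordDist v w = B * ‖u‖ / (‖u‖ * ‖v‖ * ‖w‖) := by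
    unfold coordDist; rw [← hB]; field_simp
  have hD : 0 < ‖u‖ * ‖v‖ * ‖w‖ := by positivity
  rw [e1, e2, e3]
  rcases le_max_iff.1 key with h | h
  · exact le_max_of_le_left ((div_le_div_iff_of_pos_right hD).2 h)
  · exact le_max_of_le_right ((div_le_div_iff_of_pos_right hD).2 h)

theorem coordDist_nonneg (v w : Fin 2 → ℚ_[p]) : 0 ≤ coordDist v w := by
  unfold coordDist; positivity

theorem coordDist_eq_zero {v w : Fin 2 → ℚ_[p]} (hv : v ≠ 0) (hw : w ≠ 0)
    (h : coordDist v w = 0) : ∃ a : ℚ_[p], a • w = v := by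
  have h0 : v 0 * w 1 - w 0 * v 1 = 0 := by
    unfold coordDist at h
    rcases div_eq_zero_iff.1 h with h | h
    · exact norm_eq_zero.1 h
    · rcases mul_eq_zero.1 h with h | h
      · exact absurd (norm_eq_zero.1 h) hv
      · exact absurd (norm_eq_zero.1 h) hw
  by_cases h1 : w 1 = 0
  · have h2 : w 0 ≠ 0 := by
      intro h2; apply hw; ext i; fin_cases i <;> simp [h1, h2]
    have h3 : v 1 = 0 := by
      rw [h1] at h0; simpa [h2] using h0
    refine ⟨v 0 / w 0, ?_⟩
    ext i; fin_cases i <;> simp [h1, h2, h3]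
  · refine ⟨v 1 / w 1, ?_⟩
    ext i; fin_cases i
    · simp; field_simp; linear_combination -h0
    · simp [h1]

instance : MetricSpace (P1 p) where
  dist := sphericalDist
  dist_self P := by simp [sphericalDist, coordDist]
  dist_comm P Q := by
    change coordDist _ _ = coordDist _ _
    unfold coordDist
    rw [norm_sub_rev, mul_comm ‖P.rep‖]
  dist_triangle P Q R := by
    change coordDist _ _ ≤ coordDist _ _ + coordDist _ _
    exact (coordDist_ultra _ Q.rep _ P.rep_nonzero Q.rep_nonzero R.rep_nonzero).trans
      (max_le_add_of_nonneg (coordDist_nonneg _ _) (coordDist_nonneg _ _))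
  eq_of_dist_eq_zero {P Q} h := by
    rw [← P.mk_rep, ← Q.mk_rep, Projectivization.mk_eq_mk_iff']
    exact coordDist_eq_zero P.rep_nonzero Q.rep_nonzero h

/-- The ball `B_n(a) = {x : ρ(x, a) ≤ p^{-n}}`. -/
def ball (a : P1 p) (n : ℕ) : Set (P1 p) := {x | dist x a ≤ ((p : ℝ) ^ n)⁻¹}

end Metric

/-! ### Rational maps -/

section RationalMaps

variable {K : Type*} [Field K]

/-- The degree of a rational map: the maximum of the degrees of the numerator and the
denominator in lowest terms. -/
def ratDegree (φ : RatFunc K) : ℕ := max φ.num.natDegree φ.denom.natDegree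

/-- The homogenization of degree `d` of `f`, evaluated at `v`:
`∑_{i ≤ d} a_i x^i y^(d-i)` for `v = (x, y)`. -/
def homEval (f : K[X]) (d : ℕ) (v : Fin 2 → K) : K :=
  ∑ i ∈ Finset.range (d + 1), f.coeff i * v 0 ^ i * v 1 ^ (d - i)

theorem homEval_smul (f : K[X]) (d : ℕ) (t : K) (v : Fin 2 → K) :
    homEval f d (t • v) = t ^ d * homEval f d v := by
  unfold homEval
  rw [Finset.mul_sum]
  refine Finset.sum_congr rfl fun i hi => ?_
  have hi' : i + (d - i) = d := by have := Finset.mem_range.1 hi; omega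
  simp only [Pi.smul_apply, smul_eq_mul, mul_pow]
  calc f.coeff i * (t ^ i * v 0 ^ i) * (t ^ (d - i) * v 1 ^ (d - i))
      = t ^ (i + (d - i)) * (f.coeff i * v 0 ^ i * v 1 ^ (d - i)) := by rw [pow_add]; ring
    _ = _ := by rw [hi']

theorem homEval_of_ne_zero (f : K[X]) (d : ℕ) (hd : f.natDegree ≤ d) (v : Fin 2 → K)
    (hv : v 1 ≠ 0) : homEval f d v = v 1 ^ d * f.eval (v 0 / v 1) := by
  unfold homEval
  rw [Polynomial.eval_eq_sum_range' (Nat.lt_succ_of_le hd), Finset.mul_sum]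
  refine Finset.sum_congr rfl fun i hi => ?_
  have hi' : v 1 ^ d = v 1 ^ i * v 1 ^ (d - i) := by
    rw [← pow_add]; congr 1; have := Finset.mem_range.1 hi; omega
  rw [hi', div_pow]
  field_simp

theorem homEval_of_eq_zero (f : K[X]) (d : ℕ) (v : Fin 2 → K)
    (hv : v 1 = 0) : homEval f d v = f.coeff d * v 0 ^ d := by
  unfold homEval
  rw [Finset.sum_range_succ, Finset.sum_eq_zero]
  · simp
  · intro i hi
    have : d - i ≠ 0 := by have := Finset.mem_range.1 hi; omega
    simp [hv, this]

/-- The homogeneous lift `(F, G)` of the rational map `φ`. -/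
def homLift (φ : RatFunc K) (v : Fin 2 → K) : Fin 2 → K :=
  ![homEval φ.num (ratDegree φ) v, homEval φ.denom (ratDegree φ) v]

theorem homLift_smul (φ : RatFunc K) (t : K) (v : Fin 2 → K) :
    homLift φ (t • v) = t ^ ratDegree φ • homLift φ v := by
  ext i
  fin_cases i <;> simp [homLift, homEval_smul]

theorem homLift_ne_zero (φ : RatFunc K) {v : Fin 2 → K} (hv : v ≠ 0) : homLift φ v ≠ 0 := by
  intro h
  have hF : homEval φ.num (ratDegree φ) v = 0 := by simpa [homLift] using congrFun h 0
  have hG : homEval φ.denom (ratDegree φ) v = 0 := by simpa [homLift] using congrFun h 1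
  by_cases h1 : v 1 = 0
  · have h0 : v 0 ≠ 0 := by
      intro h0; apply hv; ext i; fin_cases i <;> simp [h0, h1]
    rw [homEval_of_eq_zero _ _ _ h1] at hF hG
    have hF' : φ.num.coeff (ratDegree φ) = 0 := by simpa [h0] using hF
    have hG' : φ.denom.coeff (ratDegree φ) = 0 := by simpa [h0] using hG
    rcases le_total φ.num.natDegree φ.denom.natDegree with hle | hle
    · rw [ratDegree, max_eq_right hle, Polynomial.coeff_natDegree] at hG'
      exact φ.denom_ne_zero (Polynomial.leadingCoeff_eq_zero.1 hG')
    · rw [ratDegree, max_eq_left hle, Polynomial.coeff_natDegree] at hF'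
      have hn : φ.num = 0 := Polynomial.leadingCoeff_eq_zero.1 hF'
      have hd : φ.denom.natDegree = 0 := by simpa [hn] using hle
      rw [ratDegree, max_eq_left hle, hn, Polynomial.natDegree_zero, ← hd,
        Polynomial.coeff_natDegree] at hG'
      exact φ.denom_ne_zero (Polynomial.leadingCoeff_eq_zero.1 hG')
  · rw [homEval_of_ne_zero _ (ratDegree φ) (le_max_left _ _) _ h1] at hF
    rw [homEval_of_ne_zero _ (ratDegree φ) (le_max_right _ _) _ h1] at hG
    have hF' : φ.num.eval (v 0 / v 1) = 0 := by simpa [h1] using hF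
    have hG' : φ.denom.eval (v 0 / v 1) = 0 := by simpa [h1] using hG
    obtain ⟨a, b, hab⟩ := φ.isCoprime_num_denom
    have := congrArg (Polynomial.eval (v 0 / v 1)) hab
    simp [hF', hG'] at this

/-- The transformation of the projective line induced by the rational map `φ`:
`[x : y] ↦ [F(x, y) : G(x, y)]`. -/
def ratMap (φ : RatFunc K) :
    Projectivization K (Fin 2 → K) → Projectivization K (Fin 2 → K) :=
  Projectivization.lift
    (fun v => Projectivization.mk K (homLift φ v.1) (homLift_ne_zero φ v.2))
    (fun a b t h => by
      rw [Projectivization.mk_eq_mk_iff']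
      exact ⟨t ^ ratDegree φ, by rw [h, homLift_smul]⟩)

end RationalMaps

/-- Good reduction: `φ` is written as `f / g` with `f, g ∈ ℤ_p[z]` having no common factors and
at least one coefficient of `f` or `g` of absolute value `1`, and the reduced rational
function `f̄ / ḡ ∈ 𝔽_p(z)` has the same degree as `φ`. If `ḡ = 0` the reduction is the constant
`∞`, of degree `0`; the quotient `f̄ / 0 = 0` has the same degree. -/
def HasGoodReduction {p : ℕ} [Fact p.Prime] (φ : RatFunc ℚ_[p]) : Prop :=
  ∃ f g : ℤ_[p][X], g ≠ 0 ∧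
    IsCoprime (f.map PadicInt.Coe.ringHom) (g.map PadicInt.Coe.ringHom) ∧
    (∃ i, ‖f.coeff i‖ = 1 ∨ ‖g.coeff i‖ = 1) ∧
    φ = algebraMap ℚ_[p][X] (RatFunc ℚ_[p]) (f.map PadicInt.Coe.ringHom) /
        algebraMap ℚ_[p][X] (RatFunc ℚ_[p]) (g.map PadicInt.Coe.ringHom) ∧
    ratDegree (algebraMap (ZMod p)[X] (RatFunc (ZMod p)) (f.map PadicInt.toZMod) /
        algebraMap (ZMod p)[X] (RatFunc (ZMod p)) (g.map PadicInt.toZMod)) = ratDegree φ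

/-! ### Minimal components -/

/-- `E` is a nonempty clopen set, a finite union of balls, invariant under `φ`, and every orbit
in `E` is dense in `E`. -/
structure IsMinimalComponent {p : ℕ} [Fact p.Prime] (φ : RatFunc ℚ_[p]) (E : Set (P1 p)) :
    Prop where
  nonempty : E.Nonempty
  isClopen : IsClopen E
  finite_union_balls : ∃ T : Finset (P1 p × ℕ), (∀ t ∈ T, 1 ≤ t.2) ∧ E = ⋃ t ∈ T, ball t.1 t.2
  mapsTo : Set.MapsTo (ratMap φ) E E
  dense_orbit : ∀ x ∈ E, E ⊆ closure (Set.range fun n : ℕ => (ratMap φ)^[n] x)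

/-! ### Odometers -/

/-- The odometer with structure sequence `s`: the inverse limit of the rings `ℤ/(s n)ℤ`,
with the topology induced by the product of the discrete topologies. -/
def odometer (s : ℕ → ℕ) (hs : ∀ n, s n ∣ s (n + 1)) : Subring (∀ n, ZMod (s n)) where
  carrier := {x | ∀ n, ZMod.castHom (hs n) (ZMod (s n)) (x (n + 1)) = x n}
  mul_mem' ha hb n := by rw [Pi.mul_apply, map_mul, ha n, hb n, Pi.mul_apply]
  one_mem' n := by rw [Pi.one_apply, map_one, Pi.one_apply]
  add_mem' ha hb n := by rw [Pi.add_apply, map_add, ha n, hb n, Pi.add_apply]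
  zero_mem' n := by rw [Pi.zero_apply, map_zero, Pi.zero_apply]
  neg_mem' ha n := by rw [Pi.neg_apply, map_neg, ha n, Pi.neg_apply]

/-- The adding machine `z ↦ z + 1`. -/
def addingMachine (s : ℕ → ℕ) (hs : ∀ n, s n ∣ s (n + 1)) (z : odometer s hs) :
    odometer s hs := z + 1

/-- The sequence `(k, kℓ, kℓp, kℓp², …)`. -/
def structureSeq (p k l : ℕ) : ℕ → ℕ
  | 0 => k
  | n + 1 => k * l * p ^ n

theorem structureSeq_dvd (p k l : ℕ) : ∀ n, structureSeq p k l n ∣ structureSeq p k l (n + 1)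
  | 0 => ⟨l, by simp [structureSeq]⟩
  | n + 1 => ⟨p, by simp [structureSeq, pow_succ, mul_assoc]⟩

/-- Topological conjugacy of dynamical systems. -/
def TopConjugate {X Y : Type*} [TopologicalSpace X] [TopologicalSpace Y]
    (f : X → X) (g : Y → Y) : Prop :=
  ∃ h : X ≃ₜ Y, Function.Semiconj h f g

end PadicGoodReduction

end

/-!
Good reduction means that, in the coordinates `z` and `1 / z`, the map `φ` is a quotient of integral
polynomials whose denominator is a unit on each residue disc. Hence `φ` is `1`-Lipschitz, and its
difference quotients on a disc are `p`-adic integers with constant residue, the multiplier.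

Since `ρ` is an ultrametric, an orbit in `E` returns to the ball of radius `p⁻ⁿ⁻¹` around its
starting point exactly at the multiples of some `s n`. Discs of radius `p⁻¹` are counted by
`ℙ¹(𝔽_p)`, so `s 0 ≤ p + 1`. In the ball of radius `p⁻ⁿ⁻¹` the map `φ^(s n)` acts on the subballs
of radius `p⁻ⁿ⁻²` as an affine map `z ↦ c z + a` of `𝔽_p`, where `c` is a power of the multiplier
`β` of `φ^(s 0)`. Hence the ratio `s (n + 1) / s n` is `1`, the order of `c`, or `p` when `c = 1`;
after one factor equal to the order `ℓ` of `β`, every further `c` is `1`. As `E` has no isolated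
points, `s` is unbounded, and its supernatural limit is that of `(k, kℓ, kℓp, …)` with `k = s 0`.
The residues modulo `s n` of the times of an orbit extend continuously to `E`, and together give
the conjugacy with the odometer.
-/

namespace PadicGoodReduction

open Filter Topology

/-! ### Return times -/

section ReturnTimes

variable {X : Type*}

theorem iterate_eq_iterate_iff_modEq {f : X → X} {x : X} (hx : x ∈ Function.periodicPts f)
    {a b : ℕ} : f^[a] x = f^[b] x ↔ a ≡ b [MOD Function.minimalPeriod f x] := by
  have hpos := Function.minimalPeriod_pos_of_mem_periodicPts hx
  rw [← Function.iterate_mod_minimalPeriod_eq (n := a),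
    ← Function.iterate_mod_minimalPeriod_eq (n := b),
    Function.iterate_eq_iterate_iff_of_lt_minimalPeriod (Nat.mod_lt _ hpos) (Nat.mod_lt _ hpos)]
  rfl

/-- The return time of the orbit of `x` under `T` at scale `r`: two points of the orbit are
`r`-close exactly when their times are congruent modulo `s`. -/
def IsReturnTime [PseudoMetricSpace X] (T : X → X) (x : X) (r : ℝ) (s : ℕ) : Prop :=
  ∀ a b : ℕ, dist (T^[a] x) (T^[b] x) ≤ r ↔ a ≡ b [MOD s]

section PseudoMetric

variable [PseudoMetricSpace X] {T : X → X} {x : X} {r r' : ℝ} {s s' k : ℕ}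

theorem IsReturnTime.dist_iterate_le_iff (h : IsReturnTime T x r s) {a : ℕ} :
    dist (T^[a] x) x ≤ r ↔ s ∣ a :=
  (h a 0).trans Nat.modEq_zero_iff_dvd

theorem IsReturnTime.dist_iterate_le (h : IsReturnTime T x r s) : dist (T^[s] x) x ≤ r :=
  h.dist_iterate_le_iff.2 dvd_rfl

theorem IsReturnTime.dvd (h : IsReturnTime T x r s) (h' : IsReturnTime T x r' s')
    (hr : r' ≤ r) : s ∣ s' :=
  h.dist_iterate_le_iff.1 (h'.dist_iterate_le.trans hr)

theorem IsReturnTime.iterate (h : IsReturnTime T x r (k * s)) (hk : k ≠ 0) :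
    IsReturnTime T^[k] x r s := fun a b => by
  rw [← Function.iterate_mul, ← Function.iterate_mul, h, Nat.ModEq.mul_left_cancel_iff' hk]

theorem IsReturnTime.restrict {E : Set X} (hE : Set.MapsTo T E E) {x : E}
    (h : IsReturnTime T x r s) : IsReturnTime (hE.restrict T E E) x r s := fun a b => by
  simpa only [Subtype.dist_eq, hE.coe_iterate_restrict] using h a b

theorem dist_map_le (hT : LipschitzWith 1 T) (x y : X) : dist (T x) (T y) ≤ dist x y := by
  simpa using hT.dist_le_mul x y

theorem exists_pos_dist_iterate_le {E : Set X} (hE : Set.MapsTo T E E)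
    (hmin : ∀ y ∈ E, E ⊆ closure (Set.range fun n => T^[n] y)) (hx : x ∈ E) (hr : 0 < r) :
    ∃ m, 0 < m ∧ dist (T^[m] x) x ≤ r := by
  obtain ⟨_, ⟨m, rfl⟩, hm⟩ := Metric.mem_closure_iff.1 (hmin _ (hE hx) hx) r hr
  exact ⟨m + 1, m.succ_pos, (dist_comm _ _).trans_le hm.le⟩

theorem denseRange_iterate_restrict {E : Set X} (hE : Set.MapsTo T E E) {x : E}
    (hx : E ⊆ closure (Set.range fun n => T^[n] x)) :
    DenseRange fun n => (hE.restrict T E E)^[n] x := by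
  rw [DenseRange, Subtype.dense_iff, ← Set.range_comp]
  simpa only [Function.comp_def, hE.coe_iterate_restrict] using hx

variable [IsUltrametricDist X]

theorem dist_iterate_self_le (hT : LipschitzWith 1 T) (h : dist (T x) x ≤ r) (j : ℕ) :
    dist (T^[j] x) x ≤ r := by
  induction j with
  | zero => simpa using dist_nonneg.trans h
  | succ j ih =>
    rw [Function.iterate_succ_apply']
    exact (dist_triangle_max _ (T x) _).trans (max_le ((dist_map_le hT _ _).trans ih) h)

theorem exists_isReturnTime (hT : LipschitzWith 1 T)
    (hrec : ∃ m, 0 < m ∧ dist (T^[m] x) x ≤ r) : ∃ s, 0 < s ∧ IsReturnTime T x r s := by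
  obtain ⟨m, hm, hmr⟩ := hrec
  let S : Setoid X :=
    { r := fun y z => dist y z ≤ r
      iseqv :=
        { refl := fun y => (dist_self y).trans_le (dist_nonneg.trans hmr)
          symm := fun {y z} h => by rwa [dist_comm]
          trans := fun h h' => (dist_triangle_max _ _ _).trans (max_le h h') } }
  let T' : Quotient S → Quotient S := Quotient.map T fun y z h => (dist_map_le hT y z).trans h
  have hT' : Function.Semiconj (Quotient.mk S) T T' := fun _ => rfl
  have hclass : ∀ a b, dist (T^[a] x) (T^[b] x) ≤ r ↔ T'^[a] ⟦x⟧ = T'^[b] ⟦x⟧ := fun a b => by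
    rw [← hT'.iterate_right a x, ← hT'.iterate_right b x]
    exact (Quotient.eq (r := S)).symm
  have hper : (⟦x⟧ : Quotient S) ∈ Function.periodicPts T' :=
    Function.mk_mem_periodicPts hm ((hclass m 0).1 hmr)
  exact ⟨_, Function.minimalPeriod_pos_of_mem_periodicPts hper, fun a b =>
    (hclass a b).trans (iterate_eq_iterate_iff_modEq hper)⟩

end PseudoMetric

theorem exists_returnTime_not_dvd [MetricSpace X] {T : X → X} {x : X} {r : ℕ → ℝ} {s : ℕ → ℕ}
    (hr : Tendsto r atTop (𝓝 0)) (hs : ∀ n, IsReturnTime T x (r n) (s n))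
    (hinf : (Set.range fun n => T^[n] x).Infinite) {m : ℕ} (hm : 0 < m) : ∃ n, ¬ s n ∣ m := by
  by_contra! hdvd
  have hper : Function.IsPeriodicPt T m x := dist_le_zero.1
    (ge_of_tendsto' hr fun n => (hs n).dist_iterate_le_iff.2 (hdvd n))
  refine hinf (((Set.finite_Iio m).image fun n => T^[n] x).subset ?_)
  rintro _ ⟨n, rfl⟩
  exact ⟨n % m, Nat.mod_lt n hm, hper.iterate_mod_apply n⟩

end ReturnTimes

/-! ### Odometers as factors of ultrametric systems -/

section Odometer

variable {X : Type*}

theorem topConjugate_addingMachine_of_factors [TopologicalSpace X] [CompactSpace X] {T : X → X}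
    {x₀ : X} (hdense : DenseRange fun n => T^[n] x₀) {t : ℕ → ℕ} [∀ n, NeZero (t n)]
    (ht : ∀ n, t n ∣ t (n + 1)) (π : ∀ n, X → ZMod (t n)) (hcont : ∀ n, Continuous (π n))
    (hsemi : ∀ n, Function.Semiconj (π n) T (· + 1)) (hzero : ∀ n, π n x₀ = 0)
    (hsep : ∀ x y, (∀ n, π n x = π n y) → x = y) : TopConjugate T (addingMachine t ht) := by
  have horbit : ∀ n a, π n (T^[a] x₀) = a := fun n a => by
    simp [(hsemi n).iterate_right a x₀, hzero]
  have hcompat : ∀ n x, ZMod.castHom (ht n) (ZMod (t n)) (π (n + 1) x) = π n x := fun n =>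
    congrFun <| hdense.equalizer (continuous_of_discreteTopology.comp (hcont (n + 1))) (hcont n) <|
      funext fun a => by simp only [Function.comp_apply, horbit, map_natCast]
  let H : X → odometer t ht := fun x => ⟨fun n => π n x, fun n => hcompat n x⟩
  have hH : Continuous H := Continuous.subtype_mk (continuous_pi hcont) _
  have hinj : Function.Injective H := fun x y hxy =>
    hsep x y fun n => congrFun (congrArg Subtype.val hxy) n
  have hsurj : Function.Surjective H := by
    intro z
    have hclosed : ∀ n, IsClosed {x | π n x = z.1 n} := fun n =>
      isClosed_eq (hcont n) continuous_const
    obtain ⟨x, hx⟩ := IsCompact.nonempty_iInter_of_sequence_nonempty_isCompact_isClosed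
      (fun n => {x | π n x = z.1 n})
      (fun n x (hx : _ = _) => show _ = _ by rw [← hcompat, hx, z.2 n])
      (fun n => by
        obtain ⟨a, ha⟩ := ZMod.natCast_zmod_surjective (z.1 n)
        exact ⟨T^[a] x₀, (horbit n a).trans ha⟩)
      (hclosed 0).isCompact hclosed
    exact ⟨x, Subtype.ext (funext fun n => Set.mem_iInter.1 hx n)⟩
  exact ⟨hH.homeoOfEquivCompactToT2 (f := Equiv.ofBijective H ⟨hinj, hsurj⟩),
    fun x => Subtype.ext (funext fun n => hsemi n x)⟩

theorem exists_continuous_semiconj_add_one [PseudoMetricSpace X] [IsUltrametricDist X]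
    {T : X → X} {x₀ : X} (hT : LipschitzWith 1 T)
    (hdense : DenseRange fun n => T^[n] x₀) {r : ℝ} (hr : 0 < r) {t : ℕ}
    (hclose : ∀ a b, dist (T^[a] x₀) (T^[b] x₀) ≤ r → a ≡ b [MOD t]) :
    ∃ π : X → ZMod t, Continuous π ∧ Function.Semiconj π T (· + 1) ∧ π x₀ = 0 := by
  choose A hA using fun x => hdense.exists_dist_lt x hr
  have hval : ∀ {x a}, dist x (T^[a] x₀) ≤ r → (A x : ZMod t) = a := fun {x a} h => by
    refine (ZMod.natCast_eq_natCast_iff _ _ _).2 (hclose _ _ ?_)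
    exact (dist_triangle_max _ x _).trans (max_le ((dist_comm _ _).trans_le (hA x).le) h)
  refine ⟨fun x => A x, continuous_iff_continuousAt.2 fun x => ?_, fun x => ?_, ?_⟩
  · refine ContinuousAt.congr (f := fun _ => (A x : ZMod t)) continuousAt_const ?_
    filter_upwards [Metric.closedBall_mem_nhds x hr] with y hy
    exact (hval ((dist_triangle_max _ x _).trans (max_le hy (hA x).le))).symm
  · have h : dist (T x) (T^[A x + 1] x₀) ≤ r := by
      rw [Function.iterate_succ_apply']
      exact (dist_map_le hT _ _).trans (hA x).le
    simpa using hval h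
  · simpa using hval (x := x₀) (a := 0) (by simpa using hr.le)

/-- Two sequences of positive integers are cofinal for divisibility when they have the same least
common multiple as supernatural numbers, so that they define the same odometer. -/
def DvdCofinal (s t : ℕ → ℕ) : Prop :=
  (∀ n, ∃ m, s n ∣ t m) ∧ ∀ n, ∃ m, t n ∣ s m

theorem topConjugate_addingMachine [MetricSpace X] [IsUltrametricDist X] [CompactSpace X]
    {T : X → X} {x₀ : X} (hT : LipschitzWith 1 T)
    (hdense : DenseRange fun n => T^[n] x₀) {r : ℕ → ℝ} (hr₀ : ∀ n, 0 < r n)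
    (hr : Tendsto r atTop (𝓝 0)) {s : ℕ → ℕ} (hs₀ : ∀ n, 0 < s n)
    (hs : ∀ n, IsReturnTime T x₀ (r n) (s n)) {t : ℕ → ℕ} (ht : ∀ n, t n ∣ t (n + 1))
    (hst : DvdCofinal s t) : TopConjugate T (addingMachine t ht) := by
  have (n : ℕ) : NeZero (t n) := by
    obtain ⟨m, hm⟩ := hst.2 n
    exact ⟨ne_zero_of_dvd_ne_zero (hs₀ m).ne' hm⟩
  have hclose : ∀ n, ∃ ρ > 0, ∀ a b, dist (T^[a] x₀) (T^[b] x₀) ≤ ρ → a ≡ b [MOD t n] :=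
    fun n => by
      obtain ⟨m, hm⟩ := hst.2 n
      exact ⟨r m, hr₀ m, fun a b h => ((hs m a b).1 h).of_dvd hm⟩
  choose ρ hρ₀ hρ using hclose
  choose π hcont hsemi hzero using fun n =>
    exists_continuous_semiconj_add_one hT hdense (hρ₀ n) (hρ n)
  refine topConjugate_addingMachine_of_factors hdense ht π hcont hsemi hzero fun x y hxy =>
    eq_of_forall_dist_le fun ε hε => ?_
  obtain ⟨m, hm⟩ := (hr.eventually_le_const hε).exists
  obtain ⟨n, hn⟩ := hst.1 m
  have hnear : ∀ z, ∃ a : ℕ, dist z (T^[a] x₀) < ε ∧ π n z = a := fun z => by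
    obtain ⟨_, ⟨hd, hπ⟩, a, rfl⟩ := hdense.inter_open_nonempty
      (Metric.ball z ε ∩ π n ⁻¹' {π n z})
      (Metric.isOpen_ball.inter ((isOpen_discrete _).preimage (hcont n)))
      ⟨z, Metric.mem_ball_self hε, rfl⟩
    refine ⟨a, by rwa [dist_comm], hπ.symm.trans ?_⟩
    simp [(hsemi n).iterate_right a x₀, hzero]
  obtain ⟨a, ha, hπa⟩ := hnear x
  obtain ⟨b, hb, hπb⟩ := hnear y
  have hab : a ≡ b [MOD t n] := (ZMod.natCast_eq_natCast_iff _ _ _).1 (by rw [← hπa, ← hπb, hxy])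
  have hab' : dist (T^[a] x₀) (T^[b] x₀) ≤ ε := ((hs m a b).2 (hab.of_dvd hn)).trans hm
  exact (dist_triangle_max _ _ _).trans
    (max_le ha.le ((dist_triangle_max _ _ _).trans (max_le hab' ((dist_comm _ _).trans_le hb.le))))

end Odometer

/-! ### Growth of the return times -/

section Growth

theorem eq_one_or_eq_of_dvd_iff_geom_sum {K : Type*} [Field K] [DecidableEq K] (p : ℕ) [CharP K p]
    {a c : K} {r : ℕ} (h : ∀ j, r ∣ j ↔ a * ∑ i ∈ Finset.range j, c ^ i = 0) :
    r = 1 ∨ r = if c = 1 then p else orderOf c := by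
  by_cases ha : a = 0
  · exact Or.inl (Nat.dvd_one.1 ((h 1).2 (by simp [ha])))
  refine Or.inr (Nat.dvd_right_iff_eq.1 fun j => ?_)
  rw [h, mul_eq_zero, or_iff_right ha]
  split_ifs with hc
  · simp [hc, CharP.cast_eq_zero_iff K p]
  · rw [geom_sum_eq hc, div_eq_zero_iff, or_iff_left (sub_ne_zero.2 hc), sub_eq_zero,
      orderOf_dvd_iff_pow_eq_one]

/-- The sequences of return times to balls of radii `p⁻¹, p⁻², …` of a map with multiplier `β`:
each ratio `q (n + 1) / q n` is `1` or the period of `0` under `z ↦ β ^ q n * z + a` for some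
`a ≠ 0`. -/
def IsReturnGrowth (p : ℕ) (β : ZMod p) (q : ℕ → ℕ) : Prop :=
  ∀ n, q (n + 1) = q n ∨ q (n + 1) = q n * if β ^ q n = 1 then p else orderOf (β ^ q n)

variable {p : ℕ} {β : ZMod p} {q : ℕ → ℕ}

theorem IsReturnGrowth.eq_one_or_eq (hq : IsReturnGrowth p β q) (hq₀ : q 0 = 1) (n : ℕ) :
    q n = 1 ∨ ∃ j, q n = orderOf β * p ^ j := by
  induction n with
  | zero => exact Or.inl hq₀
  | succ n ih =>
    rcases hq n with h | h
    · rwa [h]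
    right
    rcases ih with hn | ⟨j, hn⟩
    · rw [hn, one_mul, pow_one] at h
      split_ifs at h with hβ
      · exact ⟨1, by rw [h, hβ, orderOf_one, one_mul, pow_one]⟩
      · exact ⟨0, by rw [h, pow_zero, mul_one]⟩
    · have hβ : β ^ q n = 1 := by rw [hn, pow_mul, pow_orderOf_eq_one, one_pow]
      rw [if_pos hβ, hn] at h
      exact ⟨j + 1, by rw [h, pow_succ, mul_assoc]⟩

theorem IsReturnGrowth.exists_dvd (hq : IsReturnGrowth p β q) (hq₀ : q 0 = 1) (hp : 1 < p)
    (hpos : 0 < orderOf β) (hunb : ∀ m, 0 < m → ∃ n, ¬ q n ∣ m) (i : ℕ) :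
    ∃ n, orderOf β * p ^ i ∣ q n := by
  obtain ⟨n, hn⟩ := hunb (orderOf β * p ^ i) (by positivity)
  rcases hq.eq_one_or_eq hq₀ n with h | ⟨j, h⟩
  · exact absurd (h.symm ▸ one_dvd _) hn
  rcases le_total i j with hij | hij
  · exact ⟨n, h ▸ Nat.mul_dvd_mul_left _ (pow_dvd_pow p hij)⟩
  · exact absurd (h ▸ Nat.mul_dvd_mul_left _ (pow_dvd_pow p hij)) hn

theorem IsReturnGrowth.exists_dvdCofinal [hp : Fact p.Prime] (hq : IsReturnGrowth p β q)
    (hq₀ : q 0 = 1) (hpos : ∀ n, 0 < q n) (hunb : ∀ m, 0 < m → ∃ n, ¬ q n ∣ m) (k : ℕ) :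
    ∃ l, l ∣ p - 1 ∧ DvdCofinal (fun n => k * q n) (structureSeq p k l) := by
  have hord : 0 < orderOf β := by
    obtain ⟨n, hn⟩ := hunb 1 one_pos
    rcases hq.eq_one_or_eq hq₀ n with h | ⟨j, h⟩
    · exact absurd (h.symm ▸ one_dvd _) hn
    · exact pos_of_mul_pos_left (h ▸ hpos n) (Nat.zero_le _)
  have hβ : β ≠ 0 := by
    rintro rfl
    simp at hord
  refine ⟨orderOf β, orderOf_dvd_of_pow_eq_one (ZMod.pow_card_sub_one_eq_one hβ), fun n => ?_,
    fun n => ?_⟩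
  · rcases hq.eq_one_or_eq hq₀ n with h | ⟨j, h⟩
    · exact ⟨0, by simp [h, structureSeq]⟩
    · exact ⟨j + 1, by simp [h, structureSeq, mul_assoc]⟩
  · cases n with
    | zero => exact ⟨0, Dvd.intro _ rfl⟩
    | succ i =>
      obtain ⟨n, hn⟩ := hq.exists_dvd hq₀ hp.out.one_lt hord hunb i
      exact ⟨n, by simpa only [structureSeq, mul_assoc] using Nat.mul_dvd_mul_left k hn⟩

end Growth

/-! ### Coordinates on the projective line -/

section Coordinates

variable {p : ℕ} [hp : Fact p.Prime]

instance : IsUltrametricDist (P1 p) where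
  dist_triangle_max P Q R := coordDist_ultra _ _ _ P.rep_nonzero Q.rep_nonzero R.rep_nonzero

/-- The position of a homogeneous coordinate of largest absolute value, the second one in case of
a tie, so that the points of index `1` are those of the affine disc `ℤ_p`. -/
noncomputable def pivot (v : Fin 2 → ℚ_[p]) : Fin 2 := if ‖v 0‖ ≤ ‖v 1‖ then 1 else 0

theorem norm_apply_pivot (v : Fin 2 → ℚ_[p]) : ‖v (pivot v)‖ = ‖v‖ := by
  refine (norm_le_pi_norm v _).antisymm ((pi_norm_le_iff_of_nonneg (norm_nonneg _)).2 ?_)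
  rw [Fin.forall_fin_two, pivot]
  split_ifs with h
  · exact ⟨h, le_rfl⟩
  · exact ⟨le_rfl, (not_le.1 h).le⟩

theorem apply_pivot_ne_zero {v : Fin 2 → ℚ_[p]} (hv : v ≠ 0) : v (pivot v) ≠ 0 := by
  rwa [← norm_ne_zero_iff, norm_apply_pivot, norm_ne_zero_iff]

theorem pivot_smul {a : ℚ_[p]} (ha : a ≠ 0) (v : Fin 2 → ℚ_[p]) : pivot (a • v) = pivot v := by
  simp only [pivot, Pi.smul_apply, smul_eq_mul, norm_mul,
    mul_le_mul_iff_right₀ (norm_pos_iff.2 ha)]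

/-- The pivot of a point of the projective line, computed from any homogeneous coordinates. -/
noncomputable def index (P : P1 p) : Fin 2 := pivot P.rep

/-- The coordinate of a point in the closed unit disc around `0 = [0 : 1]` or `∞ = [1 : 0]`
determined by its index. -/
noncomputable def coord (P : P1 p) : ℤ_[p] :=
  ⟨P.rep (1 - index P) / P.rep (index P), by
    rw [norm_div, index, norm_apply_pivot]
    exact div_le_one_of_le₀ (norm_le_pi_norm _ _) (norm_nonneg _)⟩

theorem index_mk {v : Fin 2 → ℚ_[p]} (hv : v ≠ 0) :
    index (Projectivization.mk ℚ_[p] v hv) = pivot v := by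
  obtain ⟨a, ha⟩ := Projectivization.exists_smul_eq_mk_rep ℚ_[p] v hv
  rw [index, ← ha]
  exact pivot_smul a.ne_zero v

theorem coord_mk_mul {v : Fin 2 → ℚ_[p]} (hv : v ≠ 0) :
    (coord (Projectivization.mk ℚ_[p] v hv) : ℚ_[p]) * v (pivot v) = v (1 - pivot v) := by
  obtain ⟨a, ha⟩ := Projectivization.exists_smul_eq_mk_rep ℚ_[p] v hv
  have hpivot := apply_pivot_ne_zero hv
  change _ / _ * _ = _
  rw [index_mk, ← ha]
  simp only [Units.smul_def, Pi.smul_apply, smul_eq_mul, mul_div_mul_left _ _ a.ne_zero]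
  exact div_mul_cancel₀ _ hpivot

theorem norm_coord_lt_one {P : P1 p} (h : index P = 0) : ‖coord P‖ < 1 := by
  have hlt : ‖P.rep 1‖ < ‖P.rep 0‖ := by
    by_contra! hle
    simp [index, pivot, hle] at h
  change ‖P.rep (1 - index P) / P.rep (index P)‖ < 1
  rw [h, norm_div]
  exact (div_lt_one ((norm_nonneg _).trans_lt hlt)).2 hlt

/-- Homogeneous coordinates of the point with coordinate `z` in the chart of index `i`. -/
def chartVec {R : Type*} [One R] (i : Fin 2) (z : R) : Fin 2 → R :=
  Function.update (fun _ => z) i 1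

theorem chartVec_ne_zero {R : Type*} [Semiring R] [Nontrivial R] (i : Fin 2) (z : R) :
    chartVec i z ≠ 0 := fun h => by simpa [chartVec] using congrFun h i

theorem norm_chartVec (i : Fin 2) (z : ℤ_[p]) : ‖chartVec i (z : ℚ_[p])‖ = 1 := by
  refine ((pi_norm_le_iff_of_nonneg zero_le_one).2 fun j => ?_).antisymm ?_
  · rcases eq_or_ne j i with rfl | h <;> simp [chartVec, PadicInt.norm_le_one, *]
  · simpa [chartVec] using norm_le_pi_norm (chartVec i (z : ℚ_[p])) i

/-- The point `[1 : z]` for `i = 0` and `[z : 1]` for `i = 1`. -/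
noncomputable def chart (i : Fin 2) (z : ℤ_[p]) : P1 p :=
  Projectivization.mk ℚ_[p] (chartVec i (z : ℚ_[p])) (chartVec_ne_zero i _)

theorem chart_index_coord (P : P1 p) : chart (index P) (coord P) = P := by
  have hne : P.rep (index P) ≠ 0 := apply_pivot_ne_zero P.rep_nonzero
  conv_rhs => rw [← P.mk_rep]
  refine (Projectivization.mk_eq_mk_iff' _ _ _ _ _).2 ⟨(P.rep (index P))⁻¹, ?_⟩
  ext j
  generalize hi : index P = i at hne
  fin_cases i <;> fin_cases j <;> simp_all [chartVec, coord, div_eq_inv_mul]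

theorem dist_mk (v w : Fin 2 → ℚ_[p]) (hv : v ≠ 0) (hw : w ≠ 0) :
    dist (Projectivization.mk ℚ_[p] v hv : P1 p) (Projectivization.mk ℚ_[p] w hw) =
      coordDist v w := sphericalDist_mk v w hv hw

theorem dist_chart (i : Fin 2) (z w : ℤ_[p]) : dist (chart i z) (chart i w) = ‖z - w‖ := by
  rw [chart, chart, dist_mk, coordDist, norm_chartVec, norm_chartVec, mul_one, div_one,
    PadicInt.norm_def, PadicInt.coe_sub]
  fin_cases i
  · simp [chartVec, norm_sub_rev (w : ℚ_[p])]
  · simp [chartVec]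

theorem dist_chart_zero_one {z : ℤ_[p]} (hz : ‖z‖ < 1) (w : ℤ_[p]) :
    dist (chart 0 z) (chart 1 w) = 1 := by
  have hzw : ‖z * w‖ < 1 := by
    rw [norm_mul]
    exact mul_lt_one_of_nonneg_of_lt_one_left (norm_nonneg z) hz (PadicInt.norm_le_one w)
  rw [chart, chart, dist_mk, coordDist, norm_chartVec, norm_chartVec, mul_one, div_one]
  calc ‖chartVec 0 (z : ℚ_[p]) 0 * chartVec 1 (w : ℚ_[p]) 1
        - chartVec 1 (w : ℚ_[p]) 0 * chartVec 0 (z : ℚ_[p]) 1‖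
      = ‖1 - z * w‖ := by simp [chartVec, PadicInt.norm_def, mul_comm]
    _ = 1 := PadicInt.isUnit_iff.1
      (IsLocalRing.isUnit_one_sub_self_of_mem_nonunits _ (PadicInt.mem_nonunits.2 hzw))

theorem dist_eq_norm_coord_sub {P Q : P1 p} (h : index P = index Q) :
    dist P Q = ‖coord P - coord Q‖ := by
  conv_lhs => rw [← chart_index_coord P, ← chart_index_coord Q, h]
  exact dist_chart _ _ _

theorem dist_eq_one_of_index_ne {P Q : P1 p} (h : index P ≠ index Q) : dist P Q = 1 := by
  wlog hP : index P = 0 generalizing P Q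
  · rw [dist_comm]
    exact this h.symm (by omega)
  have hQ : index Q = 1 := by omega
  rw [← chart_index_coord P, ← chart_index_coord Q, hP, hQ]
  exact dist_chart_zero_one (norm_coord_lt_one hP) _

theorem dist_le_one (P Q : P1 p) : dist P Q ≤ 1 := by
  by_cases h : index P = index Q
  · exact (dist_eq_norm_coord_sub h).trans_le (PadicInt.norm_le_one _)
  · exact (dist_eq_one_of_index_ne h).le

theorem dist_le_inv_pow_iff {P Q : P1 p} {n : ℕ} :
    dist P Q ≤ (p : ℝ)⁻¹ ^ (n + 1) ↔
      index P = index Q ∧ (p : ℤ_[p]) ^ (n + 1) ∣ coord P - coord Q := by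
  by_cases h : index P = index Q
  · rw [dist_eq_norm_coord_sub h, and_iff_right h, ← Ideal.mem_span_singleton,
      ← PadicInt.norm_le_pow_iff_mem_span_pow, zpow_neg, zpow_natCast, inv_pow]
  · have hlt : (p : ℝ)⁻¹ ^ (n + 1) < 1 := pow_lt_one₀ (by positivity)
      (inv_lt_one_of_one_lt₀ (mod_cast hp.out.one_lt)) n.succ_ne_zero
    rw [dist_eq_one_of_index_ne h]
    exact iff_of_false hlt.not_ge fun h' => h h'.1

theorem dist_lt_one_iff {P Q : P1 p} :
    dist P Q < 1 ↔ index P = index Q ∧ (p : ℤ_[p]) ∣ coord P - coord Q := by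
  by_cases h : index P = index Q
  · rw [dist_eq_norm_coord_sub h, and_iff_right h, PadicInt.norm_lt_one_iff_dvd]
  · rw [dist_eq_one_of_index_ne h]
    exact iff_of_false (lt_irrefl 1) fun h' => h h'.1

theorem dist_lt_one_iff_dist_le_inv {P Q : P1 p} : dist P Q < 1 ↔ dist P Q ≤ (p : ℝ)⁻¹ := by
  rw [dist_lt_one_iff, ← pow_one (p : ℝ)⁻¹, ← zero_add 1, dist_le_inv_pow_iff, zero_add, pow_one]

theorem toZMod_eq_zero_iff_dvd (z : ℤ_[p]) : PadicInt.toZMod z = 0 ↔ (p : ℤ_[p]) ∣ z := by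
  rw [← RingHom.mem_ker, PadicInt.ker_toZMod, PadicInt.maximalIdeal_eq_span_p,
    Ideal.mem_span_singleton]

theorem isUnit_iff_toZMod_ne_zero (z : ℤ_[p]) : IsUnit z ↔ PadicInt.toZMod z ≠ 0 := by
  rw [Ne, toZMod_eq_zero_iff_dvd, ← PadicInt.norm_lt_one_iff_dvd, PadicInt.not_isUnit_iff.symm,
    not_not]

/-- The reduction of a point modulo `p`, a point of `ℙ¹(𝔽_p)`; `none` is the point at infinity. -/
noncomputable def residue (P : P1 p) : Option (ZMod p) :=
  if index P = 0 then none else some (PadicInt.toZMod (coord P))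

theorem dist_lt_one_of_residue_eq {P Q : P1 p} (h : residue P = residue Q) : dist P Q < 1 := by
  rw [dist_lt_one_iff]
  by_cases hP : index P = 0 <;> by_cases hQ : index Q = 0 <;>
    simp only [residue, hP, hQ, if_true, if_false, reduceCtorEq, Option.some.injEq] at h
  · refine ⟨hP.trans hQ.symm, dvd_sub ?_ ?_⟩ <;>
      exact (PadicInt.norm_lt_one_iff_dvd _).1 (norm_coord_lt_one ‹_›)
  · exact ⟨by omega, by rw [← toZMod_eq_zero_iff_dvd, map_sub, h, sub_self]⟩

theorem IsReturnTime.le_add_one {T : P1 p → P1 p} {P : P1 p} {k : ℕ}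
    (h : IsReturnTime T P (p : ℝ)⁻¹ k) : k ≤ p + 1 := by
  have hinj : Function.Injective fun i : Fin k => residue (T^[i] P) := fun i j hij => by
    have hclose := dist_lt_one_iff_dist_le_inv.1 (dist_lt_one_of_residue_eq hij)
    exact Fin.ext (((h i j).1 hclose).eq_of_lt_of_lt i.2 j.2)
  simpa [ZMod.card] using Fintype.card_le_of_injective _ hinj

instance : CompactSpace (P1 p) := by
  have hcont (i : Fin 2) : Continuous (chart (p := p) i) :=
    (Isometry.of_dist_eq fun z w => by rw [dist_chart, dist_eq_norm]).continuous
  have hcover : ⋃ i, Set.range (chart (p := p) i) = Set.univ :=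
    Set.eq_univ_of_forall fun P => Set.mem_iUnion.2 ⟨index P, coord P, chart_index_coord P⟩
  exact ⟨hcover ▸ isCompact_iUnion fun i => isCompact_range (hcont i)⟩

instance (P : P1 p) : (𝓝[≠] P).NeBot := by
  let Q (n : ℕ) : P1 p := chart (index P) (coord P + (p : ℤ_[p]) ^ n)
  have hQ : ∀ n, dist (Q n) P = (p : ℝ)⁻¹ ^ n := fun n => by
    conv_lhs => rw [← chart_index_coord P, dist_chart]
    simp
  have hlim : Tendsto Q atTop (𝓝 P) := by
    rw [tendsto_iff_dist_tendsto_zero]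
    simpa only [hQ] using tendsto_pow_atTop_nhds_zero_of_lt_one (by positivity)
      (inv_lt_one_of_one_lt₀ (mod_cast hp.out.one_lt : (1 : ℝ) < p))
  have hne : ∀ n, Q n ≠ P := fun n => by
    rw [← dist_pos, hQ]
    have := hp.out.pos
    positivity
  exact (tendsto_nhdsWithin_iff.2 ⟨hlim, Eventually.of_forall hne⟩).neBot

end Coordinates

/-! ### Maps with a multiplier -/

section Multipliers

variable {p : ℕ} [hp : Fact p.Prime]

/-- `T` preserves residue discs, and its difference quotients in the coordinates of the discs are
`p`-adic integers; those based at `P` all reduce to `M P` modulo `p`. -/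
def HasMultiplier (T : P1 p → P1 p) (M : P1 p → ZMod p) : Prop :=
  ∀ P Q, dist P Q < 1 → dist (T P) (T Q) < 1 ∧
    ∃ u : ℤ_[p], coord (T Q) - coord (T P) = u * (coord Q - coord P) ∧ PadicInt.toZMod u = M P

namespace HasMultiplier

variable {T : P1 p → P1 p} {M : P1 p → ZMod p} {P Q : P1 p}

theorem lipschitzWith_one (hT : HasMultiplier T M) : LipschitzWith 1 T := by
  refine LipschitzWith.mk_one fun P Q => ?_
  rcases le_or_gt 1 (dist P Q) with h | h
  · exact (dist_le_one _ _).trans h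
  obtain ⟨h', u, hu, -⟩ := hT P Q h
  calc dist (T P) (T Q)
      = ‖u‖ * ‖coord Q - coord P‖ := by
        rw [dist_comm, dist_eq_norm_coord_sub (dist_lt_one_iff.1 h').1.symm, hu, norm_mul]
    _ ≤ ‖coord Q - coord P‖ := mul_le_of_le_one_left (norm_nonneg _) (PadicInt.norm_le_one u)
    _ = dist P Q := by rw [dist_comm, dist_eq_norm_coord_sub (dist_lt_one_iff.1 h).1.symm]

theorem eq_of_dist_lt_one (hT : HasMultiplier T M) (h : dist P Q < 1) : M P = M Q := by
  rcases eq_or_ne P Q with rfl | hne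
  · rfl
  obtain ⟨-, u, hu, huP⟩ := hT P Q h
  obtain ⟨-, u', hu', huQ⟩ := hT Q P (by rwa [dist_comm])
  have hcoord : coord Q - coord P ≠ 0 := by
    rwa [← norm_ne_zero_iff, ← dist_eq_norm_coord_sub (dist_lt_one_iff.1 h).1.symm, dist_ne_zero,
      ne_comm]
  have huu' : u = u' := mul_right_cancel₀ hcoord (by linear_combination -hu - hu')
  rw [← huP, ← huQ, huu']

theorem iterate (hT : HasMultiplier T M) (j : ℕ) :
    HasMultiplier T^[j] fun P => ∏ i ∈ Finset.range j, M (T^[i] P) := by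
  intro P Q h
  induction j with
  | zero => exact ⟨h, 1, by simp⟩
  | succ j ih =>
    obtain ⟨hj, u, hu, huM⟩ := ih
    obtain ⟨hj', v, hv, hvM⟩ := hT _ _ hj
    simp only [Function.iterate_succ_apply']
    refine ⟨hj', v * u, by rw [hv, hu, mul_assoc], ?_⟩
    rw [map_mul, huM, hvM, Finset.prod_range_succ, mul_comm]

theorem exists_translation (hT : HasMultiplier T M) {n : ℕ}
    (hP : dist (T P) P ≤ (p : ℝ)⁻¹ ^ (n + 1)) :
    ∃ a : ZMod p, ∀ j, dist (T^[j] P) P ≤ (p : ℝ)⁻¹ ^ (n + 2) ↔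
      a * ∑ i ∈ Finset.range j, M P ^ i = 0 := by
  have hclose := dist_iterate_self_le hT.lipschitzWith_one hP
  obtain ⟨-, A, hA⟩ := dist_le_inv_pow_iff.1 hP
  have hdisplacement : ∀ j, ∃ w : ℤ_[p], coord (T^[j] P) - coord P = (p : ℤ_[p]) ^ (n + 1) * w ∧
      PadicInt.toZMod w = PadicInt.toZMod A * ∑ i ∈ Finset.range j, M P ^ i := by
    intro j
    induction j with
    | zero => exact ⟨0, by simp⟩
    | succ j ih =>
      obtain ⟨w, hw, hwM⟩ := ih
      have hlt : dist P (T^[j] P) < 1 := by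
        obtain ⟨hidx, hdvd⟩ := dist_le_inv_pow_iff.1 (hclose j)
        rw [dist_comm, dist_lt_one_iff]
        exact ⟨hidx, (dvd_pow_self _ n.succ_ne_zero).trans hdvd⟩
      obtain ⟨-, u, hu, huM⟩ := hT P _ hlt
      refine ⟨A + u * w, ?_, ?_⟩
      · rw [Function.iterate_succ_apply']
        linear_combination hA + hu + u * hw
      · rw [map_add, map_mul, huM, hwM, geom_sum_succ]
        ring
  refine ⟨PadicInt.toZMod A, fun j => ?_⟩
  obtain ⟨w, hw, hwM⟩ := hdisplacement j
  rw [dist_le_inv_pow_iff, and_iff_right (dist_le_inv_pow_iff.1 (hclose j)).1, hw,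
    pow_succ _ (n + 1), mul_dvd_mul_iff_left (pow_ne_zero _ (mod_cast hp.out.ne_zero)),
    ← toZMod_eq_zero_iff_dvd, hwM]

theorem isReturnGrowth (hT : HasMultiplier T M) {q : ℕ → ℕ} (hq₀ : q 0 = 1)
    (hpos : ∀ n, 0 < q n) (hq : ∀ n, IsReturnTime T P ((p : ℝ)⁻¹ ^ (n + 1)) (q n)) :
    IsReturnGrowth p (M P) q := by
  intro n
  have hdisc : ∀ i, dist P (T^[i] P) < 1 := fun i => by
    rw [dist_comm, dist_lt_one_iff_dist_le_inv]
    simpa using (hq 0).dist_iterate_le_iff.2 (hq₀ ▸ one_dvd i)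
  have hmult : ∏ i ∈ Finset.range (q n), M (T^[i] P) = M P ^ q n :=
    (Finset.prod_congr rfl fun i _ => (hT.eq_of_dist_lt_one (hdisc i)).symm).trans (by simp)
  obtain ⟨a, ha⟩ := (hT.iterate (q n)).exists_translation (hq n).dist_iterate_le
  obtain ⟨r, hr⟩ : q n ∣ q (n + 1) := (hq n).dvd (hq (n + 1)) <|
    pow_le_pow_of_le_one (by positivity) (inv_le_one_of_one_le₀ (mod_cast hp.out.one_le)) (by simp)
  have hdvd : ∀ j, r ∣ j ↔ a * ∑ i ∈ Finset.range j, (M P ^ q n) ^ i = 0 := fun j => by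
    rw [← hmult, ← ha, ← Function.iterate_mul, (hq (n + 1)).dist_iterate_le_iff, hr,
      Nat.mul_dvd_mul_iff_left (hpos n)]
  rcases eq_one_or_eq_of_dvd_iff_geom_sum p hdvd with h | h
  · exact Or.inl (by rw [hr, h, mul_one])
  · exact Or.inr (by rw [hr, h])

theorem exists_structureSeq (hT : HasMultiplier T M) {s : ℕ → ℕ} (hpos : ∀ n, 0 < s n)
    (hs : ∀ n, IsReturnTime T P ((p : ℝ)⁻¹ ^ (n + 1)) (s n))
    (hunb : ∀ m, 0 < m → ∃ n, ¬ s n ∣ m) :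
    ∃ k l, 0 < k ∧ k ≤ p + 1 ∧ l ∣ p - 1 ∧ DvdCofinal s (structureSeq p k l) := by
  have hdvd : ∀ n, s 0 ∣ s n := fun n => (hs 0).dvd (hs n) <|
    pow_le_pow_of_le_one (by positivity) (inv_le_one_of_one_le₀ (mod_cast hp.out.one_le)) (by simp)
  choose q hq using hdvd
  have hk := hpos 0
  have hgrowth := (hT.iterate (s 0)).isReturnGrowth (P := P) (q := q)
    (Nat.eq_of_mul_eq_mul_left hk (by rw [← hq, mul_one]))
    (fun n => Nat.pos_of_mul_pos_left (hq n ▸ hpos n))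
    fun n => (hq n ▸ hs n : IsReturnTime T P _ (s 0 * q n)).iterate hk.ne'
  have hunb' : ∀ m, 0 < m → ∃ n, ¬ q n ∣ m := fun m hm => by
    obtain ⟨n, hn⟩ := hunb (s 0 * m) (Nat.mul_pos hk hm)
    exact ⟨n, fun h => hn (hq n ▸ Nat.mul_dvd_mul_left _ h)⟩
  obtain ⟨l, hl, hcofinal⟩ := hgrowth.exists_dvdCofinal
    (Nat.eq_of_mul_eq_mul_left hk (by rw [← hq, mul_one]))
    (fun n => Nat.pos_of_mul_pos_left (hq n ▸ hpos n)) hunb' (s 0)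
  refine ⟨s 0, l, hk, IsReturnTime.le_add_one (by simpa using hs 0), hl, ?_⟩
  rwa [← funext hq] at hcofinal

theorem topConjugate_of_minimal (hT : HasMultiplier T M) {E : Set (P1 p)} (hne : E.Nonempty)
    (hclopen : IsClopen E) (hE : Set.MapsTo T E E)
    (hmin : ∀ x ∈ E, E ⊆ closure (Set.range fun n => T^[n] x)) :
    ∃ k l, 1 ≤ k ∧ k ≤ p + 1 ∧ l ∣ p - 1 ∧ TopConjugate (hE.restrict T E E)
      (addingMachine (structureSeq p k l) (structureSeq_dvd p k l)) := by
  obtain ⟨P, hP⟩ := hne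
  have hr₀ (n : ℕ) : (0 : ℝ) < (p : ℝ)⁻¹ ^ (n + 1) := by
    have := hp.out.pos
    positivity
  have hr : Tendsto (fun n : ℕ => (p : ℝ)⁻¹ ^ (n + 1)) atTop (𝓝 0) :=
    (tendsto_add_atTop_iff_nat 1).2 <| tendsto_pow_atTop_nhds_zero_of_lt_one (by positivity)
      (inv_lt_one_of_one_lt₀ (mod_cast hp.out.one_lt))
  choose s hpos hs using fun n => exists_isReturnTime hT.lipschitzWith_one
    (exists_pos_dist_iterate_le hE hmin hP (hr₀ n))
  have horbit : (Set.range fun n => T^[n] P).Infinite := fun hfin =>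
    infinite_of_mem_nhds P (hclopen.isOpen.mem_nhds hP)
      (hfin.subset (hfin.isClosed.closure_eq ▸ hmin P hP))
  obtain ⟨k, l, hk, hkp, hl, hcofinal⟩ := hT.exists_structureSeq hpos hs
    fun m hm => exists_returnTime_not_dvd hr hs horbit hm
  have : CompactSpace E := isCompact_iff_compactSpace.1 hclopen.isClosed.isCompact
  exact ⟨k, l, hk, hkp, hl, topConjugate_addingMachine
    (hT.lipschitzWith_one.lipschitzOnWith.mapsToRestrict hE)
    (denseRange_iterate_restrict hE (hmin P hP)) hr₀ hr hpos
    (fun n => (hs n).restrict hE (x := ⟨P, hP⟩)) _ hcofinal⟩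

end HasMultiplier

end Multipliers

/-! ### Lifts of rational maps -/

section IntegralLifts

variable {K : Type*} [Field K]

theorem exists_eq_mul_num_denom (f : K[X]) {g : K[X]} (hg : g ≠ 0) {φ : RatFunc K}
    (hφ : φ = algebraMap K[X] (RatFunc K) f / algebraMap K[X] (RatFunc K) g) :
    ∃ h : K[X], h ≠ 0 ∧ f = h * φ.num ∧ g = h * φ.denom := by
  obtain ⟨h, rfl⟩ : φ.denom ∣ g := hφ ▸ RatFunc.denom_div_dvd f g
  refine ⟨h, right_ne_zero_of_mul hg, mul_right_cancel₀ φ.denom_ne_zero ?_, mul_comm _ _⟩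
  rw [← (RatFunc.num_mul_eq_mul_denom_iff hg).2 hφ]
  ring

theorem exists_eq_C_mul_num_denom {f g : K[X]} (hg : g ≠ 0) {φ : RatFunc K}
    (hφ : φ = algebraMap K[X] (RatFunc K) f / algebraMap K[X] (RatFunc K) g)
    (hf : f.natDegree ≤ ratDegree φ) (hg' : g.natDegree ≤ ratDegree φ) :
    ∃ c : K, c ≠ 0 ∧ f = C c * φ.num ∧ g = C c * φ.denom := by
  obtain ⟨h, h0, rfl, rfl⟩ := exists_eq_mul_num_denom f hg hφ
  have hh : h.natDegree = 0 := by
    rw [natDegree_mul h0 φ.denom_ne_zero, ratDegree] at hg'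
    by_cases hn : φ.num = 0
    · rw [hn, natDegree_zero] at hg'
      omega
    · rw [natDegree_mul h0 hn, ratDegree] at hf
      omega
  obtain ⟨c, rfl⟩ := natDegree_eq_zero.1 hh
  exact ⟨c, C_ne_zero.1 h0, rfl, rfl⟩

theorem ratDegree_eq_of_isCoprime {f g : K[X]} (hg : g ≠ 0) (hfg : IsCoprime f g) {φ : RatFunc K}
    (hφ : φ = algebraMap K[X] (RatFunc K) f / algebraMap K[X] (RatFunc K) g) :
    ratDegree φ = max f.natDegree g.natDegree := by
  obtain ⟨h, -, hf, hg'⟩ := exists_eq_mul_num_denom f hg hφ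
  obtain ⟨c, hc, rfl⟩ := isUnit_iff.1 (hfg.isUnit_of_dvd' ⟨_, hf⟩ ⟨_, hg'⟩)
  rw [hf, hg', natDegree_C_mul hc.ne_zero, natDegree_C_mul hc.ne_zero, ratDegree]

theorem homEval_C_mul (c : K) (f : K[X]) (d : ℕ) (v : Fin 2 → K) :
    homEval (C c * f) d v = c * homEval f d v := by
  simp only [homEval, coeff_C_mul, Finset.mul_sum, mul_assoc]

theorem ratMap_eq_of_ratDegree_eq_zero {φ : RatFunc K} (hφ : ratDegree φ = 0)
    (P Q : Projectivization K (Fin 2 → K)) : ratMap φ P = ratMap φ Q := by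
  induction P with | h v hv
  induction Q with | h w hw
  refine (Projectivization.mk_eq_mk_iff' _ _ _ _ _).2 ⟨1, ?_⟩
  simp [homLift, hφ, homEval]

variable {R : Type*} [CommRing R]

/-- The homogenization of degree `d` of `f`, restricted to the chart of index `i`. -/
noncomputable def chartPoly (i : Fin 2) (d : ℕ) (f : R[X]) : R[X] :=
  ∑ m ∈ Finset.range (d + 1), C (f.coeff m) * chartVec i X 0 ^ m * chartVec i X 1 ^ (d - m)

theorem homEval_map_chartVec (σ : R →+* K) (i : Fin 2) (d : ℕ) (f : R[X]) (z : R) :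
    homEval (f.map σ) d (chartVec i (σ z)) = σ ((chartPoly i d f).eval z) := by
  simp only [homEval, chartPoly, eval_finsetSum, map_sum, coeff_map]
  refine Finset.sum_congr rfl fun m _ => ?_
  fin_cases i <;> simp [chartVec]

/-- The polynomials `F 0` and `F 1` over `R` specialize along `σ` to a numerator and a denominator
of `φ` in lowest terms. -/
def IsLiftAlong (σ : R →+* K) (F : Fin 2 → R[X]) (φ : RatFunc K) : Prop :=
  ∃ c : K, c ≠ 0 ∧ ∀ j, (F j).map σ = C c * ![φ.num, φ.denom] j

theorem isLiftAlong_of_natDegree_le {σ : R →+* K} {f g : R[X]} {φ : RatFunc K}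
    (hg : g.map σ ≠ 0)
    (hφ : φ = algebraMap K[X] (RatFunc K) (f.map σ) / algebraMap K[X] (RatFunc K) (g.map σ))
    (hfd : f.natDegree ≤ ratDegree φ) (hgd : g.natDegree ≤ ratDegree φ) :
    IsLiftAlong σ ![f, g] φ := by
  obtain ⟨c, hc, hcf, hcg⟩ :=
    exists_eq_C_mul_num_denom hg hφ (natDegree_map_le.trans hfd) (natDegree_map_le.trans hgd)
  exact ⟨c, hc, Fin.forall_fin_two.2 ⟨hcf, hcg⟩⟩

theorem IsLiftAlong.exists_smul_homLift {σ : R →+* K} {F : Fin 2 → R[X]} {φ : RatFunc K}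
    (hF : IsLiftAlong σ F φ) : ∃ c : K, c ≠ 0 ∧ ∀ i z,
      (fun j => σ ((chartPoly i (ratDegree φ) (F j)).eval z)) =
        c • homLift φ (chartVec i (σ z)) := by
  obtain ⟨c, hc, hF⟩ := hF
  refine ⟨c, hc, fun i z => funext fun j => ?_⟩
  rw [← homEval_map_chartVec, hF, homEval_C_mul]
  fin_cases j <;> rfl

theorem exists_divided_difference (σ : R →+* K) (F G : R[X]) {z z' u u' : R}
    (hz : σ z = σ z') (hG : IsUnit (G.eval z')) (hu : u * G.eval z = F.eval z)
    (hu' : u' * G.eval z' = F.eval z') :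
    ∃ q, u' - u = q * (z' - z) ∧
      σ q = σ ((wronskian G F).eval z) / σ (G.eval z) ^ 2 := by
  obtain ⟨γ, hγ⟩ := hG.exists_right_inv
  obtain ⟨a, ha⟩ := F.binomExpansion z (z' - z)
  obtain ⟨b, hb⟩ := G.binomExpansion z (z' - z)
  rw [add_sub_cancel] at ha hb
  have hσG : σ (G.eval z') = σ (G.eval z) := by simp [hb, hz]
  have hσγ : σ (G.eval z) * σ γ = 1 := by rw [← hσG, ← map_mul, hγ, map_one]
  have hσu : σ u * σ (G.eval z) = σ (F.eval z) := by rw [← map_mul, hu]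
  refine ⟨γ * (F.derivative.eval z + a * (z' - z) - u * (G.derivative.eval z + b * (z' - z))),
    ?_, ?_⟩
  · linear_combination γ * hu' - γ * hu + γ * ha - γ * u * hb - (u' - u) * hγ
  · rw [eq_div_iff (pow_ne_zero 2 (left_ne_zero_of_mul_eq_one hσγ))]
    simp only [wronskian, eval_sub, eval_mul, map_mul, map_add, map_sub, hz, sub_self, mul_zero,
      add_zero]
    linear_combination
      σ (G.eval z) * (σ (F.derivative.eval z) - σ u * σ (G.derivative.eval z)) * hσγ
        - σ (G.derivative.eval z) * hσu

end IntegralLifts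

/-! ### Good reduction -/

section GoodReduction

variable {p : ℕ} [hp : Fact p.Prime] {φ : RatFunc ℚ_[p]}

theorem HasGoodReduction.exists_isLiftAlong (hred : HasGoodReduction φ) (hφ : 0 < ratDegree φ) :
    ∃ (F : Fin 2 → ℤ_[p][X]) (ψ : RatFunc (ZMod p)), ratDegree ψ = ratDegree φ ∧
      IsLiftAlong PadicInt.Coe.ringHom F φ ∧ IsLiftAlong PadicInt.toZMod F ψ := by
  obtain ⟨f, g, hg, hfg, -, hφfg, hdeg⟩ := hred
  have hinj : Function.Injective (PadicInt.Coe.ringHom (p := p)) := Subtype.val_injective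
  have hg' : g.map PadicInt.Coe.ringHom ≠ 0 := (Polynomial.map_ne_zero_iff hinj).2 hg
  have hmax : ratDegree φ = max f.natDegree g.natDegree := by
    rw [ratDegree_eq_of_isCoprime hg' hfg hφfg, natDegree_map_eq_of_injective hinj,
      natDegree_map_eq_of_injective hinj]
  have hfd : f.natDegree ≤ ratDegree φ := hmax ▸ le_max_left _ _
  have hgd : g.natDegree ≤ ratDegree φ := hmax ▸ le_max_right _ _
  have hgbar : g.map PadicInt.toZMod ≠ 0 := fun h0 => by
    rw [← hdeg, h0, map_zero, div_zero] at hφ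
    simp [ratDegree] at hφ
  exact ⟨![f, g], _, hdeg, isLiftAlong_of_natDegree_le hg' hφfg hfd hgd,
    isLiftAlong_of_natDegree_le hgbar rfl (hdeg ▸ hfd) (hdeg ▸ hgd)⟩

theorem pivot_coe {V : Fin 2 → ℤ_[p]} (hV : ∃ j, IsUnit (V j)) :
    pivot (fun j => (V j : ℚ_[p])) = if PadicInt.toZMod (V 1) = 0 then 0 else 1 := by
  have hpivot : pivot (fun j => (V j : ℚ_[p])) = if ‖V 0‖ ≤ ‖V 1‖ then 1 else 0 := rfl
  by_cases h1 : IsUnit (V 1)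
  · rw [hpivot, if_neg ((isUnit_iff_toZMod_ne_zero _).1 h1), PadicInt.isUnit_iff.1 h1,
      if_pos (PadicInt.norm_le_one _)]
  · have h0 : IsUnit (V 0) := by simpa [Fin.exists_fin_two, h1] using hV
    rw [hpivot, PadicInt.isUnit_iff.1 h0, if_neg (PadicInt.not_isUnit_iff.1 h1).not_ge,
      if_pos (not_not.1 (mt (isUnit_iff_toZMod_ne_zero _).2 h1))]

theorem isUnit_apply_pivot {V : Fin 2 → ℤ_[p]} (hV : ∃ j, IsUnit (V j)) :
    IsUnit (V (pivot fun j => (V j : ℚ_[p]))) := by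
  obtain ⟨j, hj⟩ := hV
  refine PadicInt.isUnit_iff.2 ((PadicInt.norm_le_one _).antisymm ?_)
  calc 1 = ‖(V j : ℚ_[p])‖ := (PadicInt.isUnit_iff.1 hj).symm
    _ ≤ ‖fun j => (V j : ℚ_[p])‖ := norm_le_pi_norm (fun j => (V j : ℚ_[p])) j
    _ = _ := (norm_apply_pivot _).symm

theorem HasGoodReduction.exists_chart_lift (hred : HasGoodReduction φ) (hφ : 0 < ratDegree φ) :
    ∃ Φ : Fin 2 → Fin 2 → ℤ_[p][X], ∀ i z, (∃ j, IsUnit ((Φ i j).eval z)) ∧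
      ∃ hne : (fun j => (((Φ i j).eval z : ℤ_[p]) : ℚ_[p])) ≠ 0,
        ratMap φ (chart i z) = Projectivization.mk ℚ_[p] _ hne := by
  obtain ⟨F, ψ, hdeg, hF, hFbar⟩ := hred.exists_isLiftAlong hφ
  obtain ⟨c, hc, hlift⟩ := hF.exists_smul_homLift
  obtain ⟨e, he, hred⟩ := hFbar.exists_smul_homLift
  refine ⟨fun i j => chartPoly i (ratDegree φ) (F j), fun i z => ⟨?_, ?_⟩⟩
  · have hne := smul_ne_zero he (homLift_ne_zero ψ (chartVec_ne_zero i (PadicInt.toZMod z)))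
    rw [← hred, hdeg] at hne
    obtain ⟨j, hj⟩ := Function.ne_iff.1 hne
    exact ⟨j, (isUnit_iff_toZMod_ne_zero _).2 hj⟩
  · have hz := hlift i z
    have hne := smul_ne_zero hc (homLift_ne_zero φ (chartVec_ne_zero i (z : ℚ_[p])))
    refine ⟨fun h => hne (hz.symm.trans h), ?_⟩
    exact ((Projectivization.mk_eq_mk_iff' _ _ _ _ _).2 ⟨c, hz.symm⟩).symm

theorem HasGoodReduction.exists_coord_lift (hred : HasGoodReduction φ) (hφ : 0 < ratDegree φ) :
    ∃ Φ : Fin 2 → Fin 2 → ℤ_[p][X], ∀ P : P1 p,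
      index (ratMap φ P) =
        (if PadicInt.toZMod ((Φ (index P) 1).eval (coord P)) = 0 then 0 else 1) ∧
      IsUnit ((Φ (index P) (index (ratMap φ P))).eval (coord P)) ∧
      coord (ratMap φ P) * (Φ (index P) (index (ratMap φ P))).eval (coord P) =
        (Φ (index P) (1 - index (ratMap φ P))).eval (coord P) := by
  obtain ⟨Φ, hΦ⟩ := hred.exists_chart_lift hφ
  refine ⟨Φ, fun P => ?_⟩
  obtain ⟨hunit, hne, hmk⟩ := hΦ (index P) (coord P)
  rw [chart_index_coord] at hmk
  rw [hmk, index_mk]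
  exact ⟨pivot_coe hunit, isUnit_apply_pivot hunit, Subtype.ext (by simpa using coord_mk_mul hne)⟩

theorem HasGoodReduction.hasMultiplier (hred : HasGoodReduction φ) :
    ∃ M, HasMultiplier (ratMap φ) M := by
  rcases (ratDegree φ).eq_zero_or_pos with hφ | hφ
  · refine ⟨0, fun P Q _ => ?_⟩
    rw [ratMap_eq_of_ratDegree_eq_zero hφ P Q]
    exact ⟨by simp, 0, by simp⟩
  obtain ⟨Φ, hΦ⟩ := hred.exists_coord_lift hφ
  let F (P : P1 p) : ℤ_[p][X] := Φ (index P) (1 - index (ratMap φ P))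
  let G (P : P1 p) : ℤ_[p][X] := Φ (index P) (index (ratMap φ P))
  refine ⟨fun P => PadicInt.toZMod ((wronskian (G P) (F P)).eval (coord P)) /
    PadicInt.toZMod ((G P).eval (coord P)) ^ 2, fun P Q hPQ => ?_⟩
  obtain ⟨hindex, hdvd⟩ := dist_lt_one_iff.1 hPQ
  obtain ⟨hindexP, -, hcoordP⟩ := hΦ P
  obtain ⟨hindexQ, hunitQ, hcoordQ⟩ := hΦ Q
  have hres : PadicInt.toZMod (coord P) = PadicInt.toZMod (coord Q) := by
    rwa [← sub_eq_zero, ← map_sub, toZMod_eq_zero_iff_dvd]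
  have hindex' : index (ratMap φ P) = index (ratMap φ Q) := by
    rw [hindexP, hindexQ, ← hindex, ← eval_map_apply, ← eval_map_apply, hres]
  rw [← hindex, ← hindex'] at hunitQ hcoordQ
  obtain ⟨u, hu, huM⟩ :=
    exists_divided_difference PadicInt.toZMod (F P) (G P) hres hunitQ hcoordP hcoordQ
  refine ⟨dist_lt_one_iff.2 ⟨hindex', ?_⟩, u, hu, huM⟩
  rw [dvd_sub_comm, hu]
  exact (dvd_sub_comm.1 hdvd).mul_left u

end GoodReduction

end PadicGoodReduction

theorem theorem1p3_general (p : ℕ) [Fact p.Prime] (φ : RatFunc ℚ_[p])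
    (hred : PadicGoodReduction.HasGoodReduction φ)
    (E : Set (PadicGoodReduction.P1 p))
    (hE : PadicGoodReduction.IsMinimalComponent φ E) :
    ∃ k l : ℕ, 1 ≤ k ∧ k ≤ p + 1 ∧ l ∣ p - 1 ∧
      PadicGoodReduction.TopConjugate
        (hE.mapsTo.restrict (PadicGoodReduction.ratMap φ) E E)
        (PadicGoodReduction.addingMachine (PadicGoodReduction.structureSeq p k l)
          (PadicGoodReduction.structureSeq_dvd p k l)) := by
  obtain ⟨M, hM⟩ := hred.hasMultiplier
  exact hM.topConjugate_of_minimal hE.nonempty hE.isClopen hE.mapsTo hE.dense_orbit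

theorem theorem1p3 (p : ℕ) [Fact p.Prime] (φ : RatFunc ℚ_[p])
    (hdeg : 2 ≤ PadicGoodReduction.ratDegree φ)
    (hred : PadicGoodReduction.HasGoodReduction φ)
    (E : Set (PadicGoodReduction.P1 p))
    (hE : PadicGoodReduction.IsMinimalComponent φ E) :
    ∃ k l : ℕ, 1 ≤ k ∧ k ≤ p + 1 ∧ l ∣ p - 1 ∧
      PadicGoodReduction.TopConjugate
        (hE.mapsTo.restrict (PadicGoodReduction.ratMap φ) E E)
        (PadicGoodReduction.addingMachine (PadicGoodReduction.structureSeq p k l)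
          (PadicGoodReduction.structureSeq_dvd p k l)) := by
  exact theorem1p3_general p φ hred E hE
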